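/- Let $(\mathcal K,\prec_{\mathcal K})$ be an abstract elementary class in a finitary one-sorted signature $L(\mathcal K)$, with the amalgamation property and the joint embedding property; let $\mathrm{LS}(\mathcal K)$ be its Löwenheim–Skolem number and $|L(\mathcal K)|$ the number of symbols of its signature. For $M\in\mathcal K$ let $\text{ga-S}(M)$ be the set of Galois types of single elements over $M$. For a cardinal $\chi$, call $\mathcal K$ *$\chi$-tame* if for every $M\in\mathcal K$ and all distinct $p,p'\in\text{ga-S}(M)$ there is a strong submodel $N\prec_{\mathcal K}M$ with $|N|\le\chi$ and $p\upharpoonright N\ne p'\upharpoonright N$. For an infinite cardinal $\kappa$, call $\mathcal K$ *$\kappa$-stable* (stable in $\kappa$) if $|\text{ga-S}(M)|=\kappa$ for every $M\in\mathcal K$ with $|M|=\kappa$. Suppose that $\mathcal K$ is $\chi$-tame for some $\chi\ge\mathrm{LS}(\mathcal K)$ and $\lambda$-stable for some $\lambda$ with $\lambda\ge\chi+|L(\mathcal K)|$ and $\lambda^{\aleph_0}>\lambda$. Then $\mathcal K$ is stable in every infinite cardinal $\mu$ with $\mu^{\lambda}=\mu$. -/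

import Mathlib

open FirstOrder Cardinal

universe u

/-- An abstract elementary class in the finitary one-sorted signature `L`.
`mem M` says that the `L`-structure `M` belongs to the class, and `strong S` says that the
substructure `S` of `M` is a strong submodel of `M` (so the axiom that strong submodels are
`L`-substructures, and antisymmetry, are built in). For substructures `S`, `T` of an ambient
structure, "`S` is a strong submodel of `T`" reads
`S ≤ T ∧ strong (S.comap T.subtype.toHom)`, where the comap is `S` seen inside `T`. -/
structure AEC (L : FirstOrder.Language.{u, u}) where
  mem : ∀ (M : Type u) [L.Structure M], Prop
  strong : ∀ {M : Type u} [L.Structure M], L.Substructure M → Prop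
  /-- strong submodels and their ambient models belong to the class -/
  mem_of_strong : ∀ {M : Type u} [L.Structure M] {S : L.Substructure M},
    strong S → mem M ∧ mem S
  /-- closure of the class under isomorphism -/
  mem_iso : ∀ {M N : Type u} [L.Structure M] [L.Structure N], (M ≃[L] N) → mem M → mem N
  /-- closure of the strong submodel relation under isomorphism -/
  strong_iso : ∀ {M N : Type u} [L.Structure M] [L.Structure N] (e : M ≃[L] N)
    {S : L.Substructure M}, strong S → strong (S.map e.toHom)
  /-- reflexivity -/
  strong_top : ∀ {M : Type u} [L.Structure M], mem M → strong (⊤ : L.Substructure M)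
  /-- transitivity -/
  strong_trans : ∀ {M : Type u} [L.Structure M] {S T : L.Substructure M}, S ≤ T →
    strong (S.comap T.subtype.toHom) → strong T → strong S
  /-- The union `U` of a continuous increasing chain of strong submodels, indexed by a nonempty
  well-order, is in the class, and each member of the chain is a strong submodel of it. -/
  union_chain : ∀ {ι : Type u} [LinearOrder ι] [WellFoundedLT ι] [Nonempty ι]
    {U : Type u} [L.Structure U] (S : ι → L.Substructure U),
    (∀ i, mem (S i)) →
    (∀ i j, i ≤ j → S i ≤ S j ∧ strong ((S i).comap (S j).subtype.toHom)) →
    (∀ i, Order.IsSuccLimit i → (S i : Set U) = ⋃ j : Set.Iio i, (S j : Set U)) →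
    (⋃ i, (S i : Set U)) = Set.univ →
    mem U ∧ ∀ i, strong (S i)
  /-- If moreover all members of the chain are strong submodels of `M`, so is their union. -/
  union_chain_strong : ∀ {ι : Type u} [LinearOrder ι] [WellFoundedLT ι] [Nonempty ι]
    {M : Type u} [L.Structure M] (S : ι → L.Substructure M) (T : L.Substructure M),
    (∀ i j, i ≤ j → S i ≤ S j ∧ strong ((S i).comap (S j).subtype.toHom)) →
    (∀ i, Order.IsSuccLimit i → (S i : Set M) = ⋃ j : Set.Iio i, (S j : Set M)) →
    (T : Set M) = (⋃ i, (S i : Set M)) →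
    (∀ i, strong (S i)) → strong T
  /-- coherence -/
  coherence : ∀ {M : Type u} [L.Structure M] {S T : L.Substructure M},
    strong S → strong T → S ≤ T → strong (S.comap T.subtype.toHom)
  /-- downward Löwenheim–Skolem -/
  lowenheimSkolem : ∃ κ : Cardinal.{u}, ℵ₀ ≤ κ ∧
    ∀ (M : Type u) [L.Structure M], mem M → ∀ A : Set M,
      ∃ S : L.Substructure M, A ⊆ S ∧ strong S ∧ #S ≤ #A + κ

namespace AEC

variable {L : FirstOrder.Language.{u, u}} (K : AEC L)

/-- The Löwenheim–Skolem number: the least infinite cardinal witnessing the downward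
Löwenheim–Skolem axiom. -/
noncomputable def LS : Cardinal.{u} :=
  sInf {κ : Cardinal.{u} | ℵ₀ ≤ κ ∧
    ∀ (M : Type u) [L.Structure M], K.mem M → ∀ A : Set M,
      ∃ S : L.Substructure M, A ⊆ S ∧ K.strong S ∧ #S ≤ #A + κ}

/-- Strong embeddings: `L`-embeddings whose image is a strong submodel. -/
def IsStrong {M N : Type u} [L.Structure M] [L.Structure N] (f : M ↪[L] N) : Prop :=
  K.strong f.toHom.range

/-- The joint embedding property. -/
def JEP : Prop :=
  ∀ (M₁ M₂ : Type u) [L.Structure M₁] [L.Structure M₂], K.mem M₁ → K.mem M₂ →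
    ∃ (M : Type u) (_ : L.Structure M) (f₁ : M₁ ↪[L] M) (f₂ : M₂ ↪[L] M),
      K.IsStrong f₁ ∧ K.IsStrong f₂

/-- The amalgamation property. -/
def AP : Prop :=
  ∀ (M₀ M₁ M₂ : Type u) [L.Structure M₀] [L.Structure M₁] [L.Structure M₂]
    (f₁ : M₀ ↪[L] M₁) (f₂ : M₀ ↪[L] M₂), K.IsStrong f₁ → K.IsStrong f₂ →
    ∃ (N : Type u) (_ : L.Structure N) (g₁ : M₁ ↪[L] N) (g₂ : M₂ ↪[L] N),
      K.IsStrong g₁ ∧ K.IsStrong g₂ ∧ g₁.comp f₁ = g₂.comp f₂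

variable {K} in
theorem IsStrong.mem_dom {M N : Type u} [L.Structure M] [L.Structure N] {f : M ↪[L] N}
    (hf : K.IsStrong f) : K.mem M :=
  K.mem_iso f.equivRange.symm (K.mem_of_strong hf).2

variable {K} in
theorem IsStrong.mem_cod {M N : Type u} [L.Structure M] [L.Structure N] {f : M ↪[L] N}
    (hf : K.IsStrong f) : K.mem N :=
  (K.mem_of_strong hf).1

variable {K} in
theorem IsStrong.map {M N : Type u} [L.Structure M] [L.Structure N] {f : M ↪[L] N}
    (hf : K.IsStrong f) {S : L.Substructure M} (hS : K.strong S) :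
    K.strong (S.map f.toHom) := by
  have h1 := K.strong_iso f.equivRange hS
  have hle : S.map f.toHom ≤ f.toHom.range := by
    rintro x ⟨y, _, rfl⟩
    exact ⟨y, rfl⟩
  refine K.strong_trans hle ?_ hf
  convert h1 using 1
  ext ⟨x, hx⟩
  constructor
  · rintro ⟨y, hy, hyx⟩
    exact ⟨y, hy, Subtype.ext hyx⟩
  · rintro ⟨y, hy, hyx⟩
    exact ⟨y, hy, congrArg Subtype.val hyx⟩

variable {K} in
theorem IsStrong.comp {M N P : Type u} [L.Structure M] [L.Structure N] [L.Structure P]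
    {g : N ↪[L] P} {f : M ↪[L] N} (hg : K.IsStrong g) (hf : K.IsStrong f) :
    K.IsStrong (g.comp f) := by
  have h := hg.map hf
  unfold IsStrong
  convert h using 1
  ext x
  constructor
  · rintro ⟨y, rfl⟩
    exact ⟨f y, ⟨y, rfl⟩, rfl⟩
  · rintro ⟨_, ⟨y, rfl⟩, rfl⟩
    exact ⟨y, rfl⟩

variable {K} in
theorem isStrong_subtype {M : Type u} [L.Structure M] {S : L.Substructure M}
    (hS : K.strong S) : K.IsStrong S.subtype := by
  unfold IsStrong
  convert hS
  exact FirstOrder.Language.Substructure.range_subtype S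

/-- An element of a strong extension of `M`. -/
structure PointedExt (M : Type u) [L.Structure M] : Type (u + 1) where
  carrier : Type u
  [str : L.Structure carrier]
  emb : M ↪[L] carrier
  isStrong : K.IsStrong emb
  point : carrier

attribute [instance] PointedExt.str

/-- Two elements of strong extensions of `M` have the same type over `M` if they are identified in
some common strong extension, over `M`. -/
def PointedExt.Equiv {M : Type u} [L.Structure M] (p q : K.PointedExt M) : Prop :=
  ∃ (N : Type u) (_ : L.Structure N) (g : p.carrier ↪[L] N) (h : q.carrier ↪[L] N),
    K.IsStrong g ∧ K.IsStrong h ∧ g.comp p.emb = h.comp q.emb ∧ g p.point = h q.point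

/-- The set of Galois types over `M`: elements of strong extensions of `M`, modulo the
equivalence relation generated by `PointedExt.Equiv` (which is itself an equivalence relation
when the class has amalgamation). Inside a monster model this is the set of orbits under
the automorphisms fixing `M` pointwise, see `orbit_of_monster` and `realized_of_monster`. -/
def GaloisType (M : Type u) [L.Structure M] : Type (u + 1) :=
  Quot (PointedExt.Equiv K (M := M))

variable {K} in
/-- The restriction of a Galois type over `M` to a strong submodel. -/
def GaloisType.restrict {M : Type u} [L.Structure M] (p : K.GaloisType M)
    (S : L.Substructure M) (hS : K.strong S) : K.GaloisType S :=
  Quot.map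
    (fun r : K.PointedExt M =>
      (⟨r.carrier, r.emb.comp S.subtype, r.isStrong.comp (isStrong_subtype hS), r.point⟩ :
        K.PointedExt S))
    (by
      rintro r s ⟨N, iN, g, h, hg, hh, hc, hp⟩
      refine ⟨N, iN, g, h, hg, hh, ?_, hp⟩
      ext x
      exact congrArg (fun k : M ↪[L] N => k (S.subtype x)) hc)
    p

/-- `K` is `χ`-tame: distinct types over any `M` in the class have distinct restrictions to some
strong submodel of `M` of cardinality at most `χ`. -/
def Tame (χ : Cardinal.{u}) : Prop :=
  ∀ (M : Type u) [L.Structure M], K.mem M → ∀ p q : K.GaloisType M, p ≠ q →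
    ∃ (S : L.Substructure M) (hS : K.strong S), #S ≤ χ ∧ p.restrict S hS ≠ q.restrict S hS

/-- `K` is `κ`-Galois stable: there are exactly `κ` types over each model of cardinality `κ`. -/
def Stable (κ : Cardinal.{u}) : Prop :=
  ∀ (M : Type u) [L.Structure M], K.mem M → #M = κ →
    #(K.GaloisType M) = Cardinal.lift.{u + 1} κ

/-- `C` is a monster model: a model in which all models of smaller cardinality embed strongly, and
in which every isomorphism between strong submodels of smaller cardinality extends to an
automorphism. This is only used to check the definition of `GaloisType` against orbits. -/
structure IsMonster (C : Type u) [L.Structure C] : Prop where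
  mem : K.mem C
  large : K.LS < #C
  universal : ∀ (N : Type u) [L.Structure N], K.mem N → #N < #C →
    ∃ f : N ↪[L] C, K.IsStrong f
  homogeneous : ∀ (N : Type u) [L.Structure N] (f g : N ↪[L] C), #N < #C →
    K.IsStrong f → K.IsStrong g → ∃ σ : C ≃[L] C, ∀ x, σ (f x) = g x

theorem LS_spec : ℵ₀ ≤ K.LS ∧ ∀ (M : Type u) [L.Structure M], K.mem M → ∀ A : Set M,
    ∃ S : L.Substructure M, A ⊆ S ∧ K.strong S ∧ #S ≤ #A + K.LS :=
  csInf_mem (s := {κ : Cardinal.{u} | ℵ₀ ≤ κ ∧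
    ∀ (M : Type u) [L.Structure M], K.mem M → ∀ A : Set M,
      ∃ S : L.Substructure M, A ⊆ S ∧ K.strong S ∧ #S ≤ #A + κ}) K.lowenheimSkolem

variable {K} in
theorem IsStrong.codRestrict {M N : Type u} [L.Structure M] [L.Structure N] {f : M ↪[L] N}
    (hf : K.IsStrong f) {S : L.Substructure N} (hS : K.strong S) (h : ∀ x, f x ∈ S) :
    K.IsStrong (f.codRestrict S h) := by
  have hle : f.toHom.range ≤ S := by
    rintro _ ⟨y, rfl⟩
    exact h y
  have := K.coherence hf hS hle
  unfold IsStrong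
  convert this using 1
  ext ⟨x, hx⟩
  constructor
  · rintro ⟨y, hy⟩
    exact ⟨y, congrArg Subtype.val hy⟩
  · rintro ⟨y, hy⟩
    exact ⟨y, Subtype.ext hy⟩

variable {K} in
theorem isStrong_equiv {M N : Type u} [L.Structure M] [L.Structure N] (hM : K.mem M)
    (e : M ≃[L] N) : K.IsStrong e.toEmbedding := by
  have h := K.strong_top (K.mem_iso e hM)
  unfold IsStrong
  convert h using 1
  ext x
  exact ⟨fun _ => trivial, fun _ => ⟨e.symm x, e.apply_symm_apply x⟩⟩

variable {K} in
/-- Under amalgamation, `PointedExt.Equiv` is an equivalence relation. -/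
theorem PointedExt.equivalence (hAP : K.AP) {M : Type u} [L.Structure M] :
    Equivalence (PointedExt.Equiv K (M := M)) where
  refl p := by
    have h : K.IsStrong (FirstOrder.Language.Embedding.refl L p.carrier) :=
      isStrong_equiv p.isStrong.mem_cod (FirstOrder.Language.Equiv.refl L p.carrier)
    exact ⟨p.carrier, p.str, _, _, h, h, rfl, rfl⟩
  symm := by
    rintro p q ⟨N, iN, g, h, hg, hh, hc, hp⟩
    exact ⟨N, iN, h, g, hh, hg, hc.symm, hp.symm⟩
  trans := by
    rintro p q r ⟨N, iN, g, h, hg, hh, hc, hp⟩ ⟨N', iN', g', h', hg', hh', hc', hp'⟩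
    obtain ⟨P, iP, k, k', hk, hk', hkk⟩ := hAP q.carrier N N' h g' hh hg'
    have e : ∀ x, k (h x) = k' (g' x) := fun x => DFunLike.congr_fun hkk x
    refine ⟨P, iP, k.comp g, k'.comp h', hk.comp hg, hk'.comp hh', ?_, ?_⟩
    · ext x
      have e1 : g (p.emb x) = h (q.emb x) := DFunLike.congr_fun hc x
      have e2 : g' (q.emb x) = h' (r.emb x) := DFunLike.congr_fun hc' x
      change k (g (p.emb x)) = k' (h' (r.emb x))
      rw [e1, e, e2]
    · change k (g p.point) = k' (h' r.point)
      rw [hp, e, hp']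

/-- The Galois type over a strong submodel `M` of `C` of an element of `C`. -/
def gaTp {C : Type u} [L.Structure C] (M : L.Substructure C) (hM : K.strong M) (a : C) :
    K.GaloisType M :=
  Quot.mk _ ⟨C, M.subtype, isStrong_subtype hM, a⟩

variable {K} in
theorem exists_small {M : Type u} [L.Structure M] (hM : K.mem M) {κ : Cardinal.{u}}
    (hκ : K.LS < κ) (A : Set M) (hA : #A < κ) :
    ∃ S : L.Substructure M, A ⊆ S ∧ K.strong S ∧ #S < κ := by
  obtain ⟨S, h1, h2, h3⟩ := K.LS_spec.2 M hM A
  exact ⟨S, h1, h2, h3.trans_lt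
    (Cardinal.add_lt_of_lt (K.LS_spec.1.trans hκ.le) hA hκ)⟩

variable {K} in
/-- In a monster model, two elements have the same Galois type over a strong submodel `M`
of smaller cardinality iff they are in the same orbit under the automorphisms fixing `M`. -/
theorem orbit_of_monster (hAP : K.AP) {C : Type u} [L.Structure C] (hC : K.IsMonster C)
    (M : L.Substructure C) (hM : K.strong M) (hcard : #M < #C) (a b : C) :
    K.gaTp M hM a = K.gaTp M hM b ↔ ∃ σ : C ≃[L] C, (∀ m ∈ M, σ m = m) ∧ σ a = b := by
  have hinf : ℵ₀ ≤ #C := K.LS_spec.1.trans hC.large.le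
  constructor
  · intro h
    obtain ⟨N, iN, g₁, g₂, hg₁, hg₂, hc, hp⟩ :=
      (PointedExt.equivalence hAP).eqvGen_iff.mp (Quot.eqvGen_exact h)
    change C ↪[L] N at g₁
    change C ↪[L] N at g₂
    change g₁ a = g₂ b at hp
    have hsm : ∀ c : C, ∃ S : L.Substructure C,
        insert c (M : Set C) ⊆ S ∧ K.strong S ∧ #S < #C := fun c =>
      exists_small hC.mem hC.large _ (Cardinal.mk_insert_le.trans_lt
        (Cardinal.add_lt_of_lt hinf hcard (Cardinal.one_lt_aleph0.trans_le hinf)))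
    obtain ⟨A, hA, hAs, hAc⟩ := hsm a
    obtain ⟨B, hB, hBs, hBc⟩ := hsm b
    obtain ⟨P, hP, hPs, hPc⟩ := exists_small hg₁.mem_cod hC.large
      (g₁ '' (A : Set C) ∪ g₂ '' (B : Set C))
      ((Cardinal.mk_union_le _ _).trans_lt (Cardinal.add_lt_of_lt hinf
        (Cardinal.mk_image_le.trans_lt hAc) (Cardinal.mk_image_le.trans_lt hBc)))
    obtain ⟨j, hj⟩ := hC.universal P (K.mem_of_strong hPs).2 hPc
    have hA' : ∀ x : A, (g₁.comp A.subtype) x ∈ P := fun x =>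
      hP (Or.inl ⟨x, x.2, rfl⟩)
    have hB' : ∀ x : B, (g₂.comp B.subtype) x ∈ P := fun x =>
      hP (Or.inr ⟨x, x.2, rfl⟩)
    obtain ⟨σ, hσ⟩ := hC.homogeneous A A.subtype (j.comp ((g₁.comp A.subtype).codRestrict P hA'))
      hAc (isStrong_subtype hAs)
      (hj.comp ((hg₁.comp (isStrong_subtype hAs)).codRestrict hPs hA'))
    obtain ⟨τ, hτ⟩ := hC.homogeneous B B.subtype (j.comp ((g₂.comp B.subtype).codRestrict P hB'))
      hBc (isStrong_subtype hBs)
      (hj.comp ((hg₂.comp (isStrong_subtype hBs)).codRestrict hPs hB'))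
    have key : ∀ (x : A) (y : B), g₁ x = g₂ y → σ x = τ y := by
      intro x y hxy
      have h1 := hσ x
      have h2 := hτ y
      refine h1.trans (Eq.trans ?_ h2.symm)
      exact congrArg j (Subtype.ext hxy)
    refine ⟨τ.symm.comp σ, ?_, ?_⟩
    · intro m hm
      have := key ⟨m, hA (Or.inr hm)⟩ ⟨m, hB (Or.inr hm)⟩
        (DFunLike.congr_fun hc (⟨m, hm⟩ : M))
      change τ.symm (σ m) = m
      change σ m = τ m at this
      rw [this, τ.symm_apply_apply]
    · have := key ⟨a, hA (Or.inl rfl)⟩ ⟨b, hB (Or.inl rfl)⟩ hp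
      change τ.symm (σ a) = b
      change σ a = τ b at this
      rw [this, τ.symm_apply_apply]
  · rintro ⟨σ, hσ, rfl⟩
    refine Quot.sound ⟨C, inferInstance, σ.toEmbedding, FirstOrder.Language.Embedding.refl L C,
      isStrong_equiv hC.mem σ,
      isStrong_equiv hC.mem (FirstOrder.Language.Equiv.refl L C), ?_, rfl⟩
    ext ⟨m, hm⟩
    exact hσ m hm

variable {K} in
/-- Every Galois type over a strong submodel of smaller cardinality is the type of some element of
the monster model. -/
theorem realized_of_monster (hAP : K.AP) {C : Type u} [L.Structure C] (hC : K.IsMonster C)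
    (M : L.Substructure C) (hM : K.strong M) (hcard : #M < #C) (p : K.GaloisType M) :
    ∃ a : C, p = K.gaTp M hM a := by
  have hinf : ℵ₀ ≤ #C := K.LS_spec.1.trans hC.large.le
  obtain ⟨r, rfl⟩ := Quot.exists_rep p
  obtain ⟨S, hS, hSs, hSc⟩ := exists_small r.isStrong.mem_cod hC.large
    (insert r.point (Set.range r.emb)) (Cardinal.mk_insert_le.trans_lt
        (Cardinal.add_lt_of_lt hinf (Cardinal.mk_range_le.trans_lt hcard)
          (Cardinal.one_lt_aleph0.trans_le hinf)))
  obtain ⟨j, hj⟩ := hC.universal S (K.mem_of_strong hSs).2 hSc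
  have hf : ∀ x, r.emb x ∈ S := fun x => hS (Or.inr ⟨x, rfl⟩)
  obtain ⟨σ, hσ⟩ := hC.homogeneous M (j.comp (r.emb.codRestrict S hf)) M.subtype hcard
    (hj.comp (r.isStrong.codRestrict hSs hf)) (isStrong_subtype hM)
  have hσj : K.IsStrong (σ.toEmbedding.comp j) := (isStrong_equiv hC.mem σ).comp hj
  obtain ⟨P, iP, g, h, hg, hh, hgh⟩ := hAP S r.carrier C S.subtype (σ.toEmbedding.comp j)
    (isStrong_subtype hSs) hσj
  have e : ∀ x : S, g x = h (σ (j x)) := fun x => DFunLike.congr_fun hgh x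
  refine ⟨σ (j ⟨r.point, hS (Or.inl rfl)⟩), Quot.sound ⟨P, iP, g, h, hg, hh, ?_, ?_⟩⟩
  · ext x
    exact (e ⟨r.emb x, hf x⟩).trans (congrArg h (hσ x))
  · exact e ⟨r.point, hS (Or.inl rfl)⟩

end AEC

/-! Suppose some `M` of size `μ` carries more than `μ` types. Since `μ ^ lam = μ`, it has at most
`μ` strong submodels of size `lam`, and by `lam`-stability each carries only `lam` types. So at most
`μ` types over small submodels arise, and discarding every type over `M` that lies in a fibre of
size at most `μ` above one of them loses at most `μ` types. Each surviving type then shares its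
restriction to any small submodel with at least `lam` survivors (`exists_branching_set`). Survivors
thus form a tree with `lam` children at every node, built along an `ω`-chain of submodels of size
`lam`; tameness lets each submodel in the chain separate all siblings of its level
(`Tame.exists_separating`). Each of the `lam ^ ℵ₀` branches is a coherent sequence of types.
Coherent `ω`-sequences have limits under amalgamation alone (`GaloisType.exists_coherent_limit`), so
the union of the chain, still of size `lam`, has at least `lam ^ ℵ₀ > lam` types, against
`lam`-stability. -/

namespace AEC
open FirstOrder.Language

variable {L : FirstOrder.Language.{u, u}} {K : AEC L}

/-! ### Restriction of Galois types -/

/-- The restriction of a Galois type along a strong embedding. -/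
def GaloisType.pull {A B : Type u} [L.Structure A] [L.Structure B] (f : A ↪[L] B)
    (hf : K.IsStrong f) (p : K.GaloisType B) : K.GaloisType A :=
  Quot.map
    (fun r : K.PointedExt B =>
      (⟨r.carrier, r.emb.comp f, r.isStrong.comp hf, r.point⟩ : K.PointedExt A))
    (by
      rintro r s ⟨N, iN, g, h, hg, hh, hc, hp⟩
      refine ⟨N, iN, g, h, hg, hh, ?_, hp⟩
      ext x
      exact DFunLike.congr_fun hc (f x))
    p

theorem GaloisType.pull_pull {A B C : Type u} [L.Structure A] [L.Structure B] [L.Structure C]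
    (f : A ↪[L] B) (hf : K.IsStrong f) (g : B ↪[L] C) (hg : K.IsStrong g)
    (p : K.GaloisType C) : (p.pull g hg).pull f hf = p.pull (g.comp f) (hg.comp hf) := by
  induction p using Quot.ind
  rfl

theorem isStrong_inclusion {M : Type u} [L.Structure M] {S T : L.Substructure M}
    (hS : K.strong S) (hT : K.strong T) (h : S ≤ T) :
    K.IsStrong (Substructure.inclusion h) :=
  (isStrong_subtype hS).codRestrict hT (fun x => h x.2)

theorem GaloisType.pull_inclusion_restrict {M : Type u} [L.Structure M] {S T : L.Substructure M}
    (hS : K.strong S) (hT : K.strong T) (h : S ≤ T) (p : K.GaloisType M) :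
    (p.restrict T hT).pull _ (isStrong_inclusion hS hT h) = p.restrict S hS := by
  induction p using Quot.ind
  rfl

/-- Used contrapositively: once a submodel separates two types, so does every larger strong
submodel. -/
theorem GaloisType.restrict_eq_of_le {M : Type u} [L.Structure M] {S T : L.Substructure M}
    (hS : K.strong S) (hT : K.strong T) (h : S ≤ T) {p q : K.GaloisType M}
    (hpq : p.restrict T hT = q.restrict T hT) : p.restrict S hS = q.restrict S hS := by
  rw [← pull_inclusion_restrict hS hT h, hpq, pull_inclusion_restrict]

/-- Amalgamation makes the relation transitive, so the quotient identifies nothing further. -/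
theorem GaloisType.mk_eq_iff (hAP : K.AP) {M : Type u} [L.Structure M] {r s : K.PointedExt M} :
    (Quot.mk _ r : K.GaloisType M) = Quot.mk _ s ↔ PointedExt.Equiv K r s :=
  ⟨fun h => (PointedExt.equivalence hAP).eqvGen_iff.mp (Quot.eqvGen_exact h), Quot.sound⟩

/-- If `h` is a strong embedding, then the range of `g ∘ h` is strong inside the range of `g`. -/
theorem strong_comap_range {A B C : Type u} [L.Structure A] [L.Structure B] [L.Structure C]
    (g : B ↪[L] C) (h : A ↪[L] B) (hh : K.IsStrong h) :
    K.strong ((g.comp h).toHom.range.comap g.toHom.range.subtype.toHom) := by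
  have := K.strong_iso g.equivRange hh
  convert this using 1
  ext ⟨x, hx⟩
  constructor
  · rintro ⟨y, hy⟩
    exact ⟨h y, ⟨y, rfl⟩, Subtype.ext hy⟩
  · rintro ⟨_, ⟨y, rfl⟩, hy⟩
    exact ⟨y, congrArg Subtype.val hy⟩

/-! ### Chains of length `ω` and limits of types -/

/-- Makes the continuity clause of the chain axioms vacuous for `ω`-chains; the lift puts the index
in `Type u`, as those axioms require. -/
theorem not_isSuccLimit_ulift_nat (i : ULift.{u} ℕ) : ¬ Order.IsSuccLimit i := by
  obtain ⟨n⟩ := i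
  rintro ⟨h0, h⟩
  cases n with
  | zero => exact h0 (fun x _ => Nat.zero_le x.down)
  | succ n =>
    refine h ⟨n⟩ ⟨ULift.down_lt.1 (Nat.lt_succ_self n), fun c hc hc' => ?_⟩
    have h1 : n < c.down := hc
    have h2 : c.down < n + 1 := hc'
    omega

/-- Direct limits of `ω`-chains of strong embeddings. -/
theorem exists_nat_directLimit {D : ℕ → Type u} [∀ n, L.Structure (D n)]
    (g : ∀ n, D n ↪[L] D (n + 1)) (hg : ∀ n, K.IsStrong (g n)) :
    ∃ (P : Type u) (_ : L.Structure P) (h : ∀ n, D n ↪[L] P),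
      (∀ n, K.IsStrong (h n)) ∧ ∀ n x, h (n + 1) (g n x) = h n x := by
  let f := DirectedSystem.natLERec g
  let h := Language.DirectLimit.of L ℕ D (fun i j hij => f i j hij)
  have hf : ∀ m n (hmn : m ≤ n), K.IsStrong (f m n hmn) := by
    intro m n hmn
    induction n, hmn using Nat.le_induction with
    | base =>
      have e : f m m le_rfl = Embedding.refl L (D m) := by
        ext x
        exact DirectedSystem.map_self (f := fun i j hij => f i j hij) x
      rw [e]
      exact isStrong_equiv (hg m).mem_dom (FirstOrder.Language.Equiv.refl L (D m))
    | succ n hmn ih =>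
      have e : f m (n + 1) (hmn.trans n.le_succ) = (g n).comp (f m n hmn) := by
        ext x
        simp only [f, DirectedSystem.coe_natLERec, Embedding.comp_apply]
        exact Nat.leRecOn_succ hmn x
      rw [e]
      exact (hg n).comp ih
  have hcomp : ∀ m n (hmn : m ≤ n), (h n).comp (f m n hmn) = h m := by
    intro m n hmn
    ext x
    exact Language.DirectLimit.of_f (f := fun i j hij => f i j hij)
  refine ⟨Language.DirectLimit D (fun i j hij => f i j hij), inferInstance, h, ?_, ?_⟩
  · have key := K.union_chain (ι := ULift.{u} ℕ)
      (fun i => (h i.down).toHom.range)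
      (fun i => K.mem_iso (h i.down).equivRange (hg i.down).mem_dom)
      (fun i j hij => ?_) (fun i hi => (not_isSuccLimit_ulift_nat i hi).elim) ?_
    · exact fun n => key.2 ⟨n⟩
    · have hij' : i.down ≤ j.down := hij
      rw [← hcomp i.down j.down hij']
      refine ⟨?_, strong_comap_range _ _ (hf _ _ hij')⟩
      rintro _ ⟨x, rfl⟩
      exact ⟨_, rfl⟩
    · refine Set.eq_univ_of_forall fun z => ?_
      obtain ⟨i, x, rfl⟩ := Language.DirectLimit.exists_of z
      exact Set.mem_iUnion.2 ⟨⟨i⟩, x, rfl⟩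
  · intro n x
    have e : f n (n + 1) n.le_succ = g n := by
      ext x
      simp only [f, DirectedSystem.coe_natLERec]
      rw [Nat.leRecOn_succ le_rfl, Nat.leRecOn_self]
    rw [← hcomp n (n + 1) n.le_succ, e]
    rfl

/-- The union of an `ω`-chain of strong submodels is a strong submodel. -/
theorem strong_iSup_nat {M : Type u} [L.Structure M] {N : ℕ → L.Substructure M}
    (hN : Monotone N) (hs : ∀ n, K.strong (N n)) : K.strong (⨆ n, N n) := by
  refine K.union_chain_strong (ι := ULift.{u} ℕ) (fun i => N i.down) _
    (fun i j hij => ⟨hN hij, K.coherence (hs _) (hs _) (hN hij)⟩)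
    (fun i hi => (not_isSuccLimit_ulift_nat i hi).elim) ?_ (fun i => hs _)
  ext x
  rw [SetLike.mem_coe, Substructure.mem_iSup_of_directed hN.directed_le, Set.mem_iUnion]
  exact ⟨fun ⟨i, hi⟩ => ⟨⟨i⟩, hi⟩, fun ⟨i, hi⟩ => ⟨i.down, hi⟩⟩

/-- Compatible strong embeddings of the members of an `ω`-chain extend to a strong embedding
of the union. -/
theorem exists_isStrong_iSup {M P : Type u} [L.Structure M] [L.Structure P]
    {N : ℕ → L.Substructure M} (hN : Monotone N) (k : ∀ n, N n ↪[L] P)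
    (hk : ∀ n, K.IsStrong (k n))
    (hc : ∀ n x, k (n + 1) (Substructure.inclusion (hN n.le_succ) x) = k n x) :
    ∃ e : ↥(⨆ n, N n) ↪[L] P, K.IsStrong e ∧
      ∀ n x, e (Substructure.inclusion (le_iSup N n) x) = k n x := by
  have hc' : ∀ i j (hij : i ≤ j) x, k j (Substructure.inclusion (hN hij) x) = k i x := by
    intro i j hij
    induction j, hij using Nat.le_induction with
    | base => exact fun x => rfl
    | succ j hij ih =>
      intro x
      rw [← ih x, ← hc j]
      rfl
  let S : ℕ →o L.Substructure M := ⟨N, hN⟩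
  let lft := Language.DirectLimit.lift L ℕ (fun i => S i)
    (fun _ _ h => Substructure.inclusion (S.monotone h)) k hc'
  let e : ↥(⨆ n, N n) ↪[L] P := lft.comp (Language.DirectLimit.Equiv_iSup S).symm.toEmbedding
  have he : ∀ n x, e (Substructure.inclusion (le_iSup N n) x) = k n x := by
    intro n x
    have := Language.DirectLimit.Equiv_isup_symm_inclusion_apply S (i := n) x
    change lft ((Language.DirectLimit.Equiv_iSup S).symm (Substructure.inclusion (le_iSup N n) x)) = _
    erw [this]
    exact Language.DirectLimit.lift_of (G := fun i => S i)
      (f := fun _ _ h => Substructure.inclusion (S.monotone h)) k hc' x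
  refine ⟨e, ?_, he⟩
  have hle : ∀ i j, i ≤ j → (k i).toHom.range ≤ (k j).toHom.range := by
    rintro i j hij _ ⟨x, rfl⟩
    exact ⟨_, hc' i j hij x⟩
  -- Strength of `e` comes from the second chain axiom: its range is the union of the strong ranges
  -- of the `k n`.
  have hr : e.toHom.range = ⨆ n, (k n).toHom.range := by
    ext y
    rw [Substructure.mem_iSup_of_directed (Monotone.directed_le (fun i j => hle i j))]
    constructor
    · rintro ⟨⟨x, hx⟩, rfl⟩
      obtain ⟨n, hn⟩ := (Substructure.mem_iSup_of_directed hN.directed_le).1 hx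
      exact ⟨n, ⟨x, hn⟩, (he n ⟨x, hn⟩).symm⟩
    · rintro ⟨n, x, rfl⟩
      exact ⟨_, he n x⟩
  unfold IsStrong
  rw [hr]
  exact strong_iSup_nat (fun i j => hle i j) hk

/-- A representative of a type over the submodel extends to one of a type over the larger model. -/
theorem PointedExt.exists_lift (hAP : K.AP) {A B : Type u} [L.Structure A] [L.Structure B]
    (f : A ↪[L] B) (hf : K.IsStrong f) (q : K.GaloisType B) (r : K.PointedExt A)
    (hr : Quot.mk _ r = q.pull f hf) :
    ∃ r' : K.PointedExt B, Quot.mk _ r' = q ∧ ∃ g : r.carrier ↪[L] r'.carrier,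
      K.IsStrong g ∧ (∀ x, g (r.emb x) = r'.emb (f x)) ∧ g r.point = r'.point := by
  obtain ⟨s, rfl⟩ := Quot.exists_rep q
  obtain ⟨P, iP, g, h, hg, hh, hc, hp⟩ := (GaloisType.mk_eq_iff hAP).1 hr
  have hrefl : K.IsStrong (Embedding.refl L P) :=
    isStrong_equiv hg.mem_cod (FirstOrder.Language.Equiv.refl L P)
  -- The amalgam of `r` and `s` over `A` is itself an extension of `B` via `s`, and the identity of
  -- `P` together with `h` shows that its point still realizes `q`.
  refine ⟨⟨P, h.comp s.emb, hh.comp s.isStrong, h s.point⟩, ?_, g, hg, ?_, hp⟩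
  · exact Quot.sound ⟨P, iP, Embedding.refl L P, h, hrefl, hh, rfl, rfl⟩
  · exact fun x => DFunLike.congr_fun hc x

/-- A coherent `ω`-sequence of Galois types over an `ω`-chain of strong submodels is induced by a
Galois type over the union. -/
theorem GaloisType.exists_coherent_limit (hAP : K.AP) {M : Type u} [L.Structure M]
    {N : ℕ → L.Substructure M} (hN : Monotone N) (hs : ∀ n, K.strong (N n))
    (q : ∀ n, K.GaloisType (N n))
    (hq : ∀ n, (q (n + 1)).pull _ (isStrong_inclusion (hs n) (hs (n + 1)) (hN n.le_succ)) = q n) :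
    ∃ p : K.GaloisType ↥(⨆ n, N n), ∀ n,
      p.pull _ (isStrong_inclusion (hs n) (strong_iSup_nat hN hs) (le_iSup N n)) = q n := by
  -- Lifting representatives one level at a time turns their carriers into an `ω`-chain whose maps
  -- preserve the point; the direct limit then realizes all the types at once.
  choose next hnext g hg hge hgp using fun (n : ℕ)
      (r : {r : K.PointedExt (N n) // Quot.mk _ r = q n}) =>
    PointedExt.exists_lift hAP _ (isStrong_inclusion (hs n) (hs (n + 1)) (hN n.le_succ))
      (q (n + 1)) r.1 (r.2.trans (hq n).symm)
  let R : ∀ n, {r : K.PointedExt (N n) // Quot.mk _ r = q n} := fun n =>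
    Nat.rec ⟨_, (Quot.exists_rep (q 0)).choose_spec⟩ (fun n r => ⟨next n r, hnext n r⟩) n
  obtain ⟨P, iP, h, hh, hc⟩ := exists_nat_directLimit (K := K)
    (D := fun n => (R n).1.carrier) (fun n => g n (R n)) (fun n => hg n (R n))
  obtain ⟨e, he, hek⟩ := exists_isStrong_iSup hN (fun n => (h n).comp (R n).1.emb)
    (fun n => (hh n).comp (R n).1.isStrong) (fun n x => by
      have h1 := hge n (R n) x
      have h2 := hc n ((R n).1.emb x)
      change h (n + 1) ((R (n + 1)).1.emb _) = h n ((R n).1.emb x)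
      rw [← h2]
      exact congrArg (h (n + 1)) h1.symm)
  have hpt : ∀ n, h n (R n).1.point = h 0 (R 0).1.point := by
    intro n
    induction n with
    | zero => rfl
    | succ n ih =>
      rw [← ih, ← hc n]
      exact congrArg (h (n + 1)) (hgp n (R n)).symm
  refine ⟨Quot.mk _ ⟨P, e, he, h 0 (R 0).1.point⟩, fun n => ?_⟩
  refine Eq.trans ?_ (R n).2
  refine Quot.sound ⟨P, iP, Embedding.refl L P, h n,
    isStrong_equiv he.mem_cod (FirstOrder.Language.Equiv.refl L P), hh n, ?_, (hpt n).symm⟩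
  ext x
  exact hek n x

/-! ### Submodels of size `lam` and separation of types -/

theorem exists_strong_mk_eq {M : Type u} [L.Structure M] (hM : K.mem M) {lam : Cardinal.{u}}
    (hLS : K.LS ≤ lam) (hlam : lam ≤ #M) (A : Set M) (hA : #A ≤ lam) :
    ∃ S : L.Substructure M, A ⊆ S ∧ K.strong S ∧ #S = lam := by
  have hinf : ℵ₀ ≤ lam := K.LS_spec.1.trans hLS
  -- Padding `A` with a set of size `lam` forces the size up to exactly `lam`.
  obtain ⟨B, hB⟩ := Cardinal.le_mk_iff_exists_set.1 hlam
  obtain ⟨S, h1, h2, h3⟩ := K.LS_spec.2 M hM (A ∪ B)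
  refine ⟨S, Set.subset_union_left.trans h1, h2, le_antisymm ?_ ?_⟩
  · refine h3.trans (Cardinal.add_le_of_le hinf ((Cardinal.mk_union_le _ _).trans ?_) hLS)
    exact Cardinal.add_le_of_le hinf hA hB.le
  · rw [← hB]
    exact Cardinal.mk_le_mk_of_subset (Set.subset_union_right.trans h1)

/-- By tameness, `lam` many pairs of distinct types are separated by a strong submodel of size `lam`. -/
theorem Tame.exists_separating {χ lam : Cardinal.{u}} (htame : K.Tame χ) (hχ : χ ≤ lam)
    (hLS : K.LS ≤ lam) {M : Type u} [L.Structure M] (hM : K.mem M) (hlam : lam ≤ #M)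
    (S : L.Substructure M) (hS : K.strong S) (hSc : #S = lam)
    {I : Type u} (hI : #I ≤ lam) (a b : I → K.GaloisType M) :
    ∃ (T : L.Substructure M) (hT : K.strong T), S ≤ T ∧ #T = lam ∧
      ∀ i, a i ≠ b i → (a i).restrict T hT ≠ (b i).restrict T hT := by
  have hinf : ℵ₀ ≤ lam := K.LS_spec.1.trans hLS
  have : ∀ i, ∃ N : L.Substructure M, K.strong N ∧ #N ≤ lam ∧ (a i ≠ b i →
      ∃ hN : K.strong N, (a i).restrict N hN ≠ (b i).restrict N hN) := by
    intro i
    by_cases h : a i = b i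
    · exact ⟨S, hS, hSc.le, fun h' => (h' h).elim⟩
    · obtain ⟨N, hN, hc, hne⟩ := htame M hM _ _ h
      exact ⟨N, hN, hc.trans hχ, fun _ => ⟨hN, hne⟩⟩
  choose N hN hNc hNe using this
  obtain ⟨T, hT, hTs, hTc⟩ := exists_strong_mk_eq hM hLS hlam ((S : Set M) ∪ ⋃ i, (N i : Set M)) (by
    refine (Cardinal.mk_union_le _ _).trans (Cardinal.add_le_of_le hinf hSc.le ?_)
    refine (Cardinal.mk_iUnion_le _).trans (Cardinal.mul_le_of_le hinf hI ?_)
    exact ciSup_le' hNc)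
  refine ⟨T, hTs, Set.subset_union_left.trans hT, hTc, fun i hi heq => ?_⟩
  obtain ⟨hNi, hne⟩ := hNe i hi
  exact hne (GaloisType.restrict_eq_of_le hNi hTs
    ((Set.subset_iUnion (fun i => (N i : Set M)) i).trans (Set.subset_union_right.trans hT)) heq)

/-! ### Discarding the types in small fibres -/

/-- If there are more than `μ = μ ^ lam` types over `M`, then there is a nonempty set of types
such that, over each strong submodel of size `lam`, every type in the set agrees with `lam` many
types in the set. -/
theorem exists_branching_set {lam μ : Cardinal.{u}} (hstable : K.Stable lam)
    (hinf : ℵ₀ ≤ μ) (hlam : lam ≤ μ) (hμ : μ ^ lam = μ) {M : Type u} [L.Structure M]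
    (hMc : #M = μ) (hbig : Cardinal.lift.{u + 1} μ < #(K.GaloisType M)) :
    ∃ G : Set (K.GaloisType M), G.Nonempty ∧ ∀ p ∈ G, ∀ (S : L.Substructure M)
      (hS : K.strong S), #S = lam → ∃ F : lam.out → K.GaloisType M, Function.Injective F ∧
        ∀ i, F i ∈ G ∧ (F i).restrict S hS = p.restrict S hS := by
  have hinf' : ℵ₀ ≤ Cardinal.lift.{u + 1} μ := by simpa using hinf
  let J := {S : L.Substructure M // K.strong S ∧ #S = lam}
  let fib : (Σ j : J, K.GaloisType j.1) → Set (K.GaloisType M) :=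
    fun j => {p | p.restrict j.1.1 j.1.2.1 = j.2}
  -- The types to discard: those in some fibre of size at most `μ`.
  let B : Set (K.GaloisType M) :=
    ⋃ j : {j : Σ j : J, K.GaloisType j.1 // #(fib j) ≤ Cardinal.lift.{u + 1} μ}, fib j.1
  have hJ : #J ≤ μ := by
    have : Infinite M := Cardinal.infinite_iff.2 (hMc ▸ hinf)
    have h1 : #J ≤ #{t : Set M // #t ≤ lam} :=
      Cardinal.mk_le_of_injective (f := fun j : J => ⟨(j.1 : Set M), j.2.2.le⟩)
        (fun a b h => Subtype.ext (SetLike.coe_injective (congrArg Subtype.val h)))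
    refine h1.trans ((Cardinal.mk_bounded_set_le_of_infinite M lam).trans ?_)
    rw [hMc, hμ]
  have hsig : #(Σ j : J, K.GaloisType j.1) ≤ Cardinal.lift.{u + 1} μ := by
    have e : (fun j : J => #(K.GaloisType j.1)) = fun _ => Cardinal.lift.{u + 1} lam :=
      funext fun j => hstable j.1 (K.mem_of_strong j.2.1).2 j.2.2
    rw [Cardinal.mk_sigma, e, Cardinal.sum_const, Cardinal.lift_lift]
    refine Cardinal.mul_le_of_le (by simpa using hinf) ?_ ?_
    · exact Cardinal.lift_le.2 hJ
    · exact Cardinal.lift_le.2 hlam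
  have hB : #B ≤ Cardinal.lift.{u + 1} μ := by
    refine (Cardinal.mk_iUnion_le _).trans (Cardinal.mul_le_of_le hinf' ?_ ?_)
    · exact (Cardinal.mk_subtype_le _).trans hsig
    · exact ciSup_le' fun j => j.2
  have hdiff : ∀ X : Set (K.GaloisType M), Cardinal.lift.{u + 1} μ < #X →
      Cardinal.lift.{u + 1} μ < #(X \ B : Set _) := by
    intro X hX
    by_contra! h
    refine hX.not_ge ?_
    calc #X ≤ #(X \ B ∪ B : Set _) := Cardinal.mk_le_mk_of_subset (by simp)
      _ ≤ _ := (Cardinal.mk_union_le _ _).trans (Cardinal.add_le_of_le hinf' h hB)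
  refine ⟨Bᶜ, ?_, ?_⟩
  · have h := hdiff Set.univ (by simpa using hbig)
    have : Nonempty ↥(Set.univ \ B) := Cardinal.mk_ne_zero_iff.1 (pos_of_gt h).ne'
    obtain ⟨p, _, hp⟩ := this
    exact ⟨p, hp⟩
  · intro p hp S hS hSc
    let j : Σ j : J, K.GaloisType j.1 := ⟨⟨S, hS, hSc⟩, p.restrict S hS⟩
    have hj : Cardinal.lift.{u + 1} μ < #(fib j) := by
      by_contra! h
      exact hp (Set.mem_iUnion.2 ⟨⟨j, h⟩, rfl⟩)
    -- The fibre of a survivor has more than `μ` elements, hence still more than `μ ≥ lam` after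
    -- removing `B`.
    have hle : Cardinal.lift.{u + 1} #lam.out ≤ Cardinal.lift.{u} #(fib j \ B : Set _) := by
      rw [Cardinal.mk_out]
      have h := (hdiff _ hj).le
      exact (Cardinal.lift_le.2 hlam).trans (h.trans (Cardinal.lift_id'.{u, u + 1} _).ge)
    obtain ⟨F⟩ := Cardinal.lift_mk_le'.1 hle
    exact ⟨fun i => (F i).1, Subtype.val_injective.comp F.injective,
      fun i => ⟨(F i).2.2, (F i).2.1⟩⟩

/-! ### The tree of types and its branches -/

/-- The list of the first `n` values of a sequence, the last one first. -/
def initialList {α : Type u} (s : ℕ → α) : ℕ → List α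
  | 0 => []
  | n + 1 => s n :: initialList s n

theorem initialList_congr {α : Type u} {s t : ℕ → α} {n : ℕ} (h : ∀ m < n, s m = t m) :
    initialList s n = initialList t n := by
  induction n with
  | zero => rfl
  | succ n ih =>
    rw [initialList, initialList, ih fun m hm => h m (hm.trans n.lt_succ_self),
      h n n.lt_succ_self]

/-- A tree of types branching `lam` times at each of `ω` levels yields `lam ^ ℵ₀` many types over
some strong submodel of size `lam`. -/
theorem exists_many_types (hAP : K.AP) {χ lam : Cardinal.{u}} (htame : K.Tame χ) (hχ : χ ≤ lam)
    (hLS : K.LS ≤ lam) {M : Type u} [L.Structure M] (hM : K.mem M) (hlam : lam ≤ #M)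
    {G : Set (K.GaloisType M)} (hne : G.Nonempty)
    (hG : ∀ p ∈ G, ∀ (S : L.Substructure M) (hS : K.strong S), #S = lam →
      ∃ F : lam.out → K.GaloisType M, Function.Injective F ∧
        ∀ i, F i ∈ G ∧ (F i).restrict S hS = p.restrict S hS) :
    ∃ S : L.Substructure M, K.strong S ∧ #S = lam ∧
      Cardinal.lift.{u + 1} (lam ^ ℵ₀) ≤ #(K.GaloisType S) := by
  have hinf : ℵ₀ ≤ lam := K.LS_spec.1.trans hLS
  have hΛ : Infinite lam.out := Cardinal.infinite_iff.2 (by rwa [Cardinal.mk_out])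
  let J := {S : L.Substructure M // K.strong S ∧ #S = lam}
  have hG' : ∀ (p : G) (S : J), ∃ F : lam.out → G, Function.Injective F ∧
      ∀ i, (F i).1.restrict S.1 S.2.1 = p.1.restrict S.1 S.2.1 := by
    intro p S
    obtain ⟨F, hF, h⟩ := hG p.1 p.2 S.1 S.2.1 S.2.2
    exact ⟨fun i => ⟨F i, (h i).1⟩, fun i j hij => hF (congrArg Subtype.val hij), fun i => (h i).2⟩
  choose F hFinj hF using hG'
  -- One submodel handles all nodes and all pairs of children, since there are only `lam` triples of
  -- a list and two indices.
  have hsep : ∀ (S : J) (P : List lam.out → G), ∃ T : J, S.1 ≤ T.1 ∧ ∀ l i j, i ≠ j →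
      (F (P l) S i).1.restrict T.1 T.2.1 ≠ (F (P l) S j).1.restrict T.1 T.2.1 := by
    intro S P
    obtain ⟨T, hT, hST, hTc, h⟩ := htame.exists_separating hχ hLS hM hlam S.1 S.2.1 S.2.2
      (I := List lam.out × lam.out × lam.out)
      (by simp [Cardinal.mk_list_eq_mk, Cardinal.mul_eq_self hinf])
      (fun x => (F (P x.1) S x.2.1).1) (fun x => (F (P x.1) S x.2.2).1)
    exact ⟨⟨T, hT, hTc⟩, hST, fun l i j hij => h (l, i, j)
      (fun e => hij (hFinj _ _ (Subtype.ext e)))⟩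
  choose T hST hT using hsep
  obtain ⟨S₀, -, hS₀, hS₀c⟩ := exists_strong_mk_eq hM hLS hlam ∅ (by simp)
  -- At stage `n` only the labels of lists of length `n` matter; the value at `[]` after stage `0`
  -- is a mere default.
  let step : J × (List lam.out → G) → J × (List lam.out → G) := fun x =>
    (T x.1 x.2, fun l => match l with
      | [] => x.2 []
      | i :: l => F (x.2 l) x.1 i)
  let st : ℕ → J × (List lam.out → G) := fun n =>
    Nat.rec (⟨S₀, hS₀, hS₀c⟩, fun _ => ⟨hne.some, hne.some_mem⟩) (fun _ x => step x) n
  let N : ℕ → L.Substructure M := fun n => (st n).1.1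
  have hN : Monotone N := monotone_nat_of_le_succ fun n => hST (st n).1 (st n).2
  have hs : ∀ n, K.strong (N n) := fun n => (st n).1.2.1
  let x : (ℕ → lam.out) → ℕ → K.GaloisType M := fun s n => ((st n).2 (initialList s n)).1
  have hx : ∀ s n, x s (n + 1) = (F ((st n).2 (initialList s n)) (st n).1 (s n)).1 :=
    fun s n => rfl
  -- Coherence holds because each child is chosen to agree with its parent over the submodel of the
  -- parent's stage.
  have hlim := fun s : ℕ → lam.out => GaloisType.exists_coherent_limit hAP hN hs
    (fun n => (x s n).restrict (N n) (hs n)) (fun n => by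
      rw [GaloisType.pull_inclusion_restrict, hx]
      exact hF ((st n).2 (initialList s n)) (st n).1 (s n))
  choose y hy using hlim
  refine ⟨⨆ n, N n, strong_iSup_nat hN hs, le_antisymm ?_ ?_, ?_⟩
  · have e : ((⨆ n, N n : L.Substructure M) : Set M) = ⋃ n : ULift.{u} ℕ, (N n.down : Set M) := by
      ext x
      rw [SetLike.mem_coe, Substructure.mem_iSup_of_directed hN.directed_le, Set.mem_iUnion]
      exact ⟨fun ⟨i, hi⟩ => ⟨⟨i⟩, hi⟩, fun ⟨i, hi⟩ => ⟨i.down, hi⟩⟩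
    change #((⨆ n, N n : L.Substructure M) : Set M) ≤ lam
    rw [e]
    refine (Cardinal.mk_iUnion_le _).trans (Cardinal.mul_le_of_le hinf (by simpa using hinf) ?_)
    exact ciSup_le' fun n => (st n.down).1.2.2.le
  · calc lam = #(N 0) := (st 0).1.2.2.symm
      _ ≤ _ := Cardinal.mk_le_mk_of_subset (le_iSup N 0)
  · have hinj : Function.Injective y := by
      intro s t hst
      by_contra hne
      -- At the first difference the two branches leave a common node through distinct children,
      -- which the submodel of stage `n + 1` separates.
      obtain ⟨n, hn, hmin⟩ : ∃ n, s n ≠ t n ∧ ∀ m < n, s m = t m := by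
        classical
        have h : ∃ n, s n ≠ t n := Function.ne_iff.1 hne
        exact ⟨Nat.find h, Nat.find_spec h, fun m hm => not_not.1 (Nat.find_min h hm)⟩
      have h1 := (hy s (n + 1)).symm.trans ((congrArg _ hst).trans (hy t (n + 1)))
      simp only [hx, initialList_congr hmin] at h1
      exact hT (st n).1 (st n).2 (initialList t n) (s n) (t n) hn h1
    have := Cardinal.lift_mk_le_lift_mk_of_injective hinj
    rw [Cardinal.lift_id'.{u, u + 1}] at this
    simpa using this

/-! ### The lower bound on the number of types, and the conclusion -/

/-- Distinct elements of `M` have distinct types over `M`. -/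
theorem lift_mk_le_mk_galoisType (hAP : K.AP) {M : Type u} [L.Structure M] (hM : K.mem M) :
    Cardinal.lift.{u + 1} #M ≤ #(K.GaloisType M) := by
  have hrefl := isStrong_equiv hM (FirstOrder.Language.Equiv.refl L M)
  have hinj : Function.Injective
      (fun a : M => (Quot.mk _ ⟨M, _, hrefl, a⟩ : K.GaloisType M)) := by
    intro a b hab
    obtain ⟨N, iN, g, h, -, -, hc, hp⟩ := (GaloisType.mk_eq_iff hAP).1 hab
    have h1 : g b = h b := DFunLike.congr_fun hc b
    exact g.injective (hp.trans h1.symm)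
  have := Cardinal.lift_mk_le_lift_mk_of_injective hinj
  rwa [Cardinal.lift_id'.{u, u + 1}] at this

end AEC

theorem proposition5p3 {L : FirstOrder.Language.{u, u}} (K : AEC L)
    (hAP : K.AP) (hJEP : K.JEP)
    (χ lam : Cardinal.{u}) (hχ : K.LS ≤ χ) (htame : K.Tame χ)
    (hlam : χ + L.card ≤ lam) (hstable : K.Stable lam) (hpow : lam < lam ^ Cardinal.aleph0)
    (μ : Cardinal.{u}) (hμ_inf : Cardinal.aleph0 ≤ μ) (hμ : μ ^ lam = μ) :
    K.Stable μ := by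
  intro M _ hM hMc
  have hχl : χ ≤ lam := self_le_add_right χ L.card |>.trans hlam
  have hLS : K.LS ≤ lam := hχ.trans hχl
  have hlμ : lam ≤ μ := by
    rw [← hμ]
    exact (Cardinal.cantor' lam (Cardinal.one_lt_aleph0.trans_le hμ_inf)).le
  refine le_antisymm ?_ (hMc ▸ AEC.lift_mk_le_mk_galoisType hAP hM)
  by_contra! hbig
  obtain ⟨G, hne, hG⟩ := AEC.exists_branching_set hstable hμ_inf hlμ hμ hMc hbig
  obtain ⟨S, hS, hSc, hmany⟩ := AEC.exists_many_types hAP htame hχl hLS hM (hlμ.trans hMc.ge) hne hG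
  rw [hstable S (K.mem_of_strong hS).2 hSc, Cardinal.lift_le] at hmany
  exact hpow.not_ge hmany
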